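/- For $x\in\{0,1\}^n$ let $|x|=\sum_i x_i$ and $\mathrm{parity}(x)=(-1)^{|x|}$. For $f:\{0,1\}^n\to\{-1,1\}$ and $S\subseteq[n]$ let $\hat f(S)=\mathbb{E}_{x}\big[f(x)(-1)^{\sum_{i\in S}x_i}\big]$ ($x$ uniform in $\{0,1\}^n$) and let $\|\hat f\|_1=\sum_{S\subseteq[n]}|\hat f(S)|$. Call $f$ symmetric if it is invariant under permutations of the coordinates. For symmetric $f$, consider the pairs of integers $r_0,r_1\in[0,n/2]$ such that $f$ or $f\cdot\mathrm{parity}$ is constant on $\{x:\ r_0\le|x|\le n-r_1\}$; let $(r_0,r_1)$ be a (coordinatewise) minimal such pair and put $r(f)=\max\{r_0,r_1\}$. (Such a pair exists, and $r(f)$ does not depend on which minimal pair is taken.) Logarithms are to base $2$. Theorem. There are universal constants $0<c\le C$ such that for every $n$ and every symmetric $f:\{0,1\}^n\to\{-1,1\}$: (1) if $r(f)>1$, then $c\, r(f)\log\frac{n}{r(f)}\le\log\|\hat f\|_1\le C\, r(f)\log\frac{n}{r(f)}$, that is, $\log\|\hat f\|_1=\Theta\big(r(f)\log\frac{n}{r(f)}\big)$;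 (2) if $r(f)\le 1$, then $c\le\|\hat f\|_1\le C$, that is, $\|\hat f\|_1=\Theta(1)$; (3) if $n\ge1$, then $\log\|\hat f\|_1\le 2\,r(f)\log\frac{n}{r(f)}+3$, where $r(f)\log\frac{n}{r(f)}$ is read as $0$ if $r(f)=0$. -/

import Mathlib

open scoped BigOperators

namespace SymmetricSpectral

/-- The Hamming weight `|x| = ∑ i, x i` of `x ∈ {0,1}ⁿ`. -/
def weight {n : ℕ} (x : Fin n → Fin 2) : ℕ := ∑ i, (x i : ℕ)

/-- The character `χ_S(x) = (-1)^(∑_{i ∈ S} x_i)`. -/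
def chi {n : ℕ} (S : Finset (Fin n)) (x : Fin n → Fin 2) : ℝ := (-1) ^ (∑ i ∈ S, (x i : ℕ))

/-- The parity function with values in `{-1, 1}`. -/
def parity {n : ℕ} (x : Fin n → Fin 2) : ℝ := (-1) ^ weight x

/-- The Fourier coefficient `𝔼_x [f(x) χ_S(x)]`, with `x` uniform in `{0,1}ⁿ`. -/
noncomputable def fourierCoeff {n : ℕ} (f : (Fin n → Fin 2) → ℝ) (S : Finset (Fin n)) : ℝ :=
  (∑ x, f x * chi S x) / 2 ^ n

/-- The spectral norm: the sum of the absolute values of all Fourier coefficients. -/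
noncomputable def l1Norm {n : ℕ} (f : (Fin n → Fin 2) → ℝ) : ℝ :=
  ∑ S : Finset (Fin n), |fourierCoeff f S|

/-- `f` takes values in `{-1, 1}`. -/
def IsBoolean {n : ℕ} (f : (Fin n → Fin 2) → ℝ) : Prop := ∀ x, f x = -1 ∨ f x = 1

/-- `f` is invariant under permutations of the coordinates. -/
def IsSymmetric {n : ℕ} (f : (Fin n → Fin 2) → ℝ) : Prop :=
  ∀ (σ : Equiv.Perm (Fin n)) (x : Fin n → Fin 2), f (x ∘ σ) = f x

/-- `g` is constant on all `x` with `|x| ∈ [r₀, n - r₁]`. -/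
def ConstOn {n : ℕ} (g : (Fin n → Fin 2) → ℝ) (r₀ r₁ : ℕ) : Prop :=
  ∃ c : ℝ, ∀ x, r₀ ≤ weight x → weight x + r₁ ≤ n → g x = c

/-- The pair `p = (r₀, r₁)` of integers in `[0, n/2]` is such that `f` or `f · parity` is constant
on all `x` with `|x| ∈ [r₀, n - r₁]`. -/
def IsCutoff {n : ℕ} (f : (Fin n → Fin 2) → ℝ) (p : ℕ × ℕ) : Prop :=
  2 * p.1 ≤ n ∧ 2 * p.2 ≤ n ∧
    (ConstOn f p.1 p.2 ∨ ConstOn (fun x => f x * parity x) p.1 p.2)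

/-- The least value of `max {r₀, r₁}` over all cutoff pairs. For a symmetric Boolean function,
`exists_minimal_isCutoff` and `max_eq_r` below show that (coordinatewise) minimal cutoff pairs
exist and that `max {r₀, r₁}` equals this number for each of them. -/
noncomputable def r {n : ℕ} (f : (Fin n → Fin 2) → ℝ) : ℕ :=
  sInf {m : ℕ | ∃ p : ℕ × ℕ, IsCutoff f p ∧ m = max p.1 p.2}


/-- A symmetric function is constant on each Hamming level. -/
theorem eq_of_weight_eq {n : ℕ} {f : (Fin n → Fin 2) → ℝ} (hf : IsSymmetric f)
    {x y : Fin n → Fin 2} (h : weight x = weight y) : f x = f y := by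
  classical
  have key : ∀ z : Fin n → Fin 2, weight z = Fintype.card {i // z i = 1} := by
    intro z
    rw [weight, Fintype.card_subtype, Finset.card_filter]
    refine Finset.sum_congr rfl fun i _ => ?_
    generalize z i = a
    fin_cases a <;> simp
  rw [key, key] at h
  let e : {i // y i = 1} ≃ {i // x i = 1} := Fintype.equivOfCardEq h.symm
  have h2 : x ∘ (e.extendSubtype) = y := by
    funext i
    by_cases hi : y i = 1
    · have := e.extendSubtype_mem i hi
      simp only [Function.comp]
      rw [this, hi]
    · have := e.extendSubtype_not_mem i hi
      simp only [Function.comp]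
      generalize hx : x (e.extendSubtype i) = a at this
      generalize y i = b at hi
      fin_cases a <;> fin_cases b <;> simp_all
  rw [← h2, hf]

theorem exists_weight_eq {n k : ℕ} (hk : k ≤ n) : ∃ x : Fin n → Fin 2, weight x = k := by
  classical
  obtain ⟨S, -, hS⟩ := Finset.exists_subset_card_eq (s := (Finset.univ : Finset (Fin n)))
    (n := k) (by simpa using hk)
  refine ⟨fun i => if i ∈ S then 1 else 0, ?_⟩
  have : ∀ i, (((if i ∈ S then 1 else 0 : Fin 2)) : ℕ) = if i ∈ S then 1 else 0 := by
    intro i; split_ifs <;> rfl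
  simp [weight, this, hS]

/-- The pair `(⌊n/2⌋, ⌊n/2⌋)` is always a cutoff pair. -/
theorem isCutoff_half {n : ℕ} {f : (Fin n → Fin 2) → ℝ} (hb : IsBoolean f) (hs : IsSymmetric f) :
    IsCutoff f (n / 2, n / 2) := by
  obtain ⟨x, hx⟩ := exists_weight_eq (n := n) (k := n / 2) (by omega)
  obtain ⟨y, hy⟩ := exists_weight_eq (n := n) (k := n - n / 2) (by omega)
  refine ⟨by dsimp; omega, by dsimp; omega, ?_⟩
  have hz : ∀ z : Fin n → Fin 2, n / 2 ≤ weight z → weight z + n / 2 ≤ n →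
      (weight z = weight x ∨ weight z = weight y) := by
    intro z h1 h2; omega
  by_cases hxy : f x = f y
  · left
    refine ⟨f x, fun z h1 h2 => ?_⟩
    rcases hz z h1 h2 with h | h
    · exact eq_of_weight_eq hs h
    · rw [hxy]; exact eq_of_weight_eq hs h
  · right
    have hw : weight y = weight x + 1 := by
      have : weight x ≠ weight y := fun h => hxy (eq_of_weight_eq hs h)
      omega
    refine ⟨f x * parity x, fun z h1 h2 => ?_⟩
    rcases hz z h1 h2 with h | h
    · simp only [parity, h, eq_of_weight_eq hs h]
    · simp only [parity, h, eq_of_weight_eq hs h, hw, pow_succ]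
      rcases hb x with h3 | h3 <;> rcases hb y with h4 | h4 <;> simp_all

/-- Minimal cutoff pairs exist. -/
theorem exists_minimal_isCutoff {n : ℕ} {f : (Fin n → Fin 2) → ℝ} (hb : IsBoolean f)
    (hs : IsSymmetric f) : ∃ p : ℕ × ℕ, Minimal (IsCutoff f) p :=
  exists_minimal_of_wellFoundedLT (IsCutoff f) ⟨_, isCutoff_half hb hs⟩

theorem ConstOn.inf {n : ℕ} {g : (Fin n → Fin 2) → ℝ} {a b a' b' : ℕ}
    (ha : 2 * a ≤ n) (hb : 2 * b ≤ n) (ha' : 2 * a' ≤ n) (hb' : 2 * b' ≤ n)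
    (h : ConstOn g a b) (h' : ConstOn g a' b') : ConstOn g (min a a') (min b b') := by
  obtain ⟨c, hc⟩ := h
  obtain ⟨c', hc'⟩ := h'
  obtain ⟨x, hx⟩ := exists_weight_eq (n := n) (k := n / 2) (by omega)
  have hcc : c = c' := by
    rw [← hc x (by omega) (by omega), ← hc' x (by omega) (by omega)]
  refine ⟨c, fun z h1 h2 => ?_⟩
  by_cases h3 : a ≤ weight z ∧ weight z + b ≤ n
  · exact hc z h3.1 h3.2
  · rw [hcc]
    exact hc' z (by omega) (by omega)

theorem half_of_constOn {n : ℕ} {f : (Fin n → Fin 2) → ℝ} (hb : IsBoolean f)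
    {a b a' b' : ℕ} (h : ConstOn f a b) (h' : ConstOn (fun x => f x * parity x) a' b') :
    n ≤ max a a' + max b b' := by
  by_contra hlt
  obtain ⟨c, hc⟩ := h
  obtain ⟨c', hc'⟩ := h'
  obtain ⟨x, hx⟩ := exists_weight_eq (n := n) (k := max a a') (by omega)
  obtain ⟨y, hy⟩ := exists_weight_eq (n := n) (k := max a a' + 1) (by omega)
  have e1 := (hc x (by omega) (by omega)).trans (hc y (by omega) (by omega)).symm
  have e2 := (hc' x (by omega) (by omega)).trans (hc' y (by omega) (by omega)).symm
  simp only [parity, hx, hy, e1, pow_succ] at e2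
  have hp : ((-1 : ℝ)) ^ (max a a') ≠ 0 := pow_ne_zero _ (by norm_num)
  rcases hb y with h3 | h3 <;> rw [h3] at e2 <;> apply hp <;> linarith

/-- `r(f) = max {r₀, r₁}` for every minimal cutoff pair `(r₀, r₁)`. -/
theorem max_eq_r {n : ℕ} {f : (Fin n → Fin 2) → ℝ} (hb : IsBoolean f) {p : ℕ × ℕ}
    (hp : Minimal (IsCutoff f) p) : max p.1 p.2 = r f := by
  have hmem : max p.1 p.2 ∈ {m : ℕ | ∃ p : ℕ × ℕ, IsCutoff f p ∧ m = max p.1 p.2} :=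
    ⟨p, hp.1, rfl⟩
  refine le_antisymm ?_ (Nat.sInf_le hmem)
  obtain ⟨q, hq, hqr⟩ := Nat.sInf_mem ⟨_, hmem⟩
  change r f = _ at hqr
  rw [hqr]
  obtain ⟨p1, p2, hpc⟩ := hp.1
  obtain ⟨q1, q2, hqc⟩ := hq
  have same : IsCutoff f (min p.1 q.1, min p.2 q.2) → max p.1 p.2 ≤ max q.1 q.2 := by
    intro h
    have h5 := hp.2 h ⟨min_le_left _ _, min_le_left _ _⟩
    have h6 : p.1 ≤ min p.1 q.1 := h5.1
    have h7 : p.2 ≤ min p.2 q.2 := h5.2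
    omega
  have diff : n ≤ max p.1 q.1 + max p.2 q.2 → max p.1 p.2 ≤ max q.1 q.2 := by
    intro h
    by_contra hlt
    have h5 := hp.2 ⟨q1, q2, hqc⟩ ⟨by omega, by omega⟩
    have h6 : p.1 ≤ q.1 := h5.1
    have h7 : p.2 ≤ q.2 := h5.2
    omega
  rcases hpc with h | h <;> rcases hqc with h' | h'
  · exact same ⟨by dsimp; omega, by dsimp; omega, Or.inl (h.inf p1 p2 q1 q2 h')⟩
  · exact diff (half_of_constOn hb h h')
  · exact diff (by have := half_of_constOn hb h' h; omega)
  · exact same ⟨by dsimp; omega, by dsimp; omega, Or.inr (h.inf p1 p2 q1 q2 h')⟩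

end SymmetricSpectral

/-! A symmetric function is determined by its values `F k` on the Hamming levels. Multiplying by
parity, complementing all bits and fixing coordinates to 0 never increase the spectral norm; the
first two allow the larger of `r₀`, `r₁`, called `R`, to be placed at the low end
(`exists_normal_form`). Then `F` is constant on `R, …, n - R`, and `F (R - 1) ≠ F R = F (R + 1)`.

Upper bound: up to parity, `f` minus a constant lives on the levels within `R` of either end. The
spectral norm is at most the sum of the absolute values of a function, so binomial tails bound it,
and `sum_choose_le` estimates those by `(n/R)^(2R)`.

Lower bound, when `n/R` is bounded: exponential growth in `R` is needed. Step-two differences of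
order `t` centred at the middle level are bounded by the spectral norm times `4^t` over a binomial
coefficient of size at least `8^t` (`abs_window_mul_choose_le`). A nonconstant sign sequence of
length `2t` has a nonzero `t`-th difference, and fixing coordinates to 0 centres its window.

Lower bound, when `n/R` is large: fixing `R` coordinates to 0 and subtracting a constant leaves a
function supported on levels below `R`. Its level generating function is a polynomial of degree at
most `R - 1`. On the imaginary axis the spectral norm bounds it, while its leading coefficient is
large (`pow_le_levelNorm_of_support`). The two regimes are joined in `le_logb`. -/

namespace SymmetricSpectral

open Finset Polynomial

/-! ### Fourier analysis on the cube and operations on the spectral norm -/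

/-- The point of the cube whose set of ones is `U`. -/
def indicator {n : ℕ} (U : Finset (Fin n)) : Fin n → Fin 2 := fun i => if i ∈ U then 1 else 0

theorem indicator_bijective (n : ℕ) : Function.Bijective (indicator (n := n)) := by
  refine ⟨fun U V h => ?_, fun x => ⟨univ.filter fun i => x i = 1, ?_⟩⟩
  · ext i
    have := congrFun h i
    by_cases h1 : i ∈ U <;> by_cases h2 : i ∈ V <;> simp_all [indicator]
  · funext i
    simp only [indicator, mem_filter, mem_univ, true_and]
    generalize x i = a
    fin_cases a <;> simp

theorem indicator_val {n : ℕ} (U : Finset (Fin n)) (i : Fin n) :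
    (indicator U i : ℕ) = if i ∈ U then 1 else 0 := by
  unfold indicator; split_ifs <;> rfl

theorem weight_indicator {n : ℕ} (U : Finset (Fin n)) : weight (indicator U) = #U := by
  simp [weight, indicator_val]

theorem chi_indicator {n : ℕ} (S U : Finset (Fin n)) :
    chi S (indicator U) = (-1) ^ #(S ∩ U) := by
  simp [chi, indicator_val, Finset.sum_ite_mem]

theorem chi_indicator_comm {n : ℕ} (S U : Finset (Fin n)) :
    chi S (indicator U) = chi U (indicator S) := by
  rw [chi_indicator, chi_indicator, inter_comm]

theorem sum_cube {n : ℕ} {M : Type*} [AddCommMonoid M] (h : (Fin n → Fin 2) → M) :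
    ∑ x, h x = ∑ U : Finset (Fin n), h (indicator U) :=
  ((indicator_bijective n).sum_comp h).symm

theorem weight_le {n : ℕ} (x : Fin n → Fin 2) : weight x ≤ n := by
  obtain ⟨U, rfl⟩ := (indicator_bijective n).2 x
  rw [weight_indicator]
  simpa using card_le_univ U

theorem abs_chi {n : ℕ} (S : Finset (Fin n)) (x : Fin n → Fin 2) : |chi S x| = 1 := by
  simp [chi, abs_pow]

theorem sum_chi_mul_chi {n : ℕ} (x y : Fin n → Fin 2) :
    ∑ S, chi S x * chi S y = if x = y then 2 ^ n else 0 := by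
  have h : ∑ S : Finset (Fin n), chi S x * chi S y =
      ∏ i : Fin n, (1 + (-1 : ℝ) ^ ((x i : ℕ) + (y i : ℕ))) := by
    rw [prod_one_add, powerset_univ]
    refine sum_congr rfl fun S _ => ?_
    simp only [chi, ← pow_add, ← sum_add_distrib, prod_pow_eq_pow_sum]
  rw [h]
  split_ifs with hxy
  · subst hxy
    simp [← two_mul, pow_mul]
  · obtain ⟨i, hi⟩ := Function.ne_iff.mp hxy
    refine prod_eq_zero (mem_univ i) ?_
    generalize x i = a at hi
    generalize y i = b at hi
    fin_cases a <;> fin_cases b <;> simp_all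

/-- The cube is self-dual through `chi_indicator_comm`, so this is the other orthogonality relation
read with points and sets exchanged. -/
theorem sum_cube_chi_mul_chi {n : ℕ} (S T : Finset (Fin n)) :
    ∑ x, chi S x * chi T x = if S = T then 2 ^ n else 0 := by
  rw [sum_cube]
  simp only [chi_indicator_comm S, chi_indicator_comm T]
  rw [sum_chi_mul_chi]
  simp [(indicator_bijective n).1.eq_iff]

theorem fourier_inversion {n : ℕ} (f : (Fin n → Fin 2) → ℝ) (x : Fin n → Fin 2) :
    f x = ∑ S, fourierCoeff f S * chi S x := by
  have h : ∑ S, fourierCoeff f S * chi S x = (∑ y, f y * ∑ S, chi S y * chi S x) / 2 ^ n := by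
    simp only [fourierCoeff, div_mul_eq_mul_div, sum_mul, mul_sum, ← sum_div]
    rw [sum_comm]
    simp only [mul_assoc]
  rw [h]
  simp [sum_chi_mul_chi]

/-- Collecting terms with equal characters yields the Fourier expansion and can only cause
cancellation. `T` need not be injective, which is what makes restriction to a subcube work. -/
theorem l1Norm_le_of_eq_sum {n : ℕ} {ι : Type*} {J : Finset ι} {h : (Fin n → Fin 2) → ℝ}
    {c : ι → ℝ} {T : ι → Finset (Fin n)} (hh : ∀ x, h x = ∑ j ∈ J, c j * chi (T j) x) :
    l1Norm h ≤ ∑ j ∈ J, |c j| := by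
  classical
  have hc : ∀ S, fourierCoeff h S = ∑ j ∈ J, if T j = S then c j else 0 := by
    intro S
    have : ∑ x, h x * chi S x = ∑ j ∈ J, c j * ∑ x, chi (T j) x * chi S x := by
      simp only [hh, sum_mul, mul_sum, mul_assoc]
      exact sum_comm
    rw [fourierCoeff, this, sum_div]
    refine sum_congr rfl fun j _ => ?_
    rw [sum_cube_chi_mul_chi]
    split_ifs <;> simp
  calc l1Norm h ≤ ∑ S, ∑ j ∈ J, if T j = S then |c j| else 0 := by
        refine sum_le_sum fun S _ => ?_
        rw [hc]
        refine (abs_sum_le_sum_abs _ _).trans (sum_le_sum fun j _ => ?_)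
        split_ifs <;> simp
    _ = ∑ j ∈ J, |c j| := by
        rw [sum_comm]; simp

theorem l1Norm_nonneg {n : ℕ} (f : (Fin n → Fin 2) → ℝ) : 0 ≤ l1Norm f :=
  sum_nonneg fun _ _ => abs_nonneg _

theorem abs_le_l1Norm {n : ℕ} (f : (Fin n → Fin 2) → ℝ) (x : Fin n → Fin 2) :
    |f x| ≤ l1Norm f := by
  rw [fourier_inversion f x]
  refine (abs_sum_le_sum_abs _ _).trans (le_of_eq ?_)
  simp [abs_mul, abs_chi, l1Norm]

theorem l1Norm_le_sum_abs {n : ℕ} (f : (Fin n → Fin 2) → ℝ) : l1Norm f ≤ ∑ x, |f x| := by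
  have h : ∀ S, |fourierCoeff f S| ≤ (∑ x, |f x|) / 2 ^ n := by
    intro S
    rw [fourierCoeff, abs_div, abs_of_pos (by positivity : (0 : ℝ) < 2 ^ n)]
    gcongr
    refine (abs_sum_le_sum_abs _ _).trans (le_of_eq ?_)
    simp [abs_mul, abs_chi]
  refine (sum_le_sum fun S _ => h S).trans (le_of_eq ?_)
  simp
  field_simp

theorem l1Norm_sub_const_le {n : ℕ} (f : (Fin n → Fin 2) → ℝ) (c : ℝ) :
    l1Norm (fun x => f x - c) ≤ l1Norm f + |c| := by
  -- The extra index `none` carries the constant as a multiple of the empty character.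
  have h := l1Norm_le_of_eq_sum (h := fun x => f x - c)
    (J := (univ : Finset (Option (Finset (Fin n)))))
    (c := fun o => o.elim (-c) (fourierCoeff f)) (T := fun o => o.elim ∅ id) (fun x => by
      rw [fourier_inversion f x, Fintype.sum_option]
      simp [chi]
      ring)
  rw [Fintype.sum_option] at h
  simp only [Option.elim, abs_neg] at h
  rw [add_comm]
  exact h

theorem l1Norm_add_const_le {n : ℕ} (f : (Fin n → Fin 2) → ℝ) (c : ℝ) :
    l1Norm f ≤ l1Norm (fun x => f x - c) + |c| := by
  simpa using l1Norm_sub_const_le (fun x => f x - c) (-c)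

theorem l1Norm_mul_parity_le {n : ℕ} (f : (Fin n → Fin 2) → ℝ) :
    l1Norm (fun x => f x * parity x) ≤ l1Norm f := by
  refine l1Norm_le_of_eq_sum (J := univ) (c := fourierCoeff f) (T := fun S => Sᶜ) fun x => ?_
  rw [fourier_inversion f x, sum_mul]
  refine sum_congr rfl fun S _ => ?_
  have h : chi S x * chi S x = 1 := by
    rw [← abs_mul_abs_self, abs_chi, one_mul]
  have h2 : parity x = chi S x * chi Sᶜ x := by
    rw [parity, chi, chi, ← pow_add, sum_add_sum_compl, weight]
  rw [h2, mul_assoc, ← mul_assoc (chi S x), h, one_mul]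

/-- The spectral norm of the symmetric function with level values `F`. -/
noncomputable def levelNorm (n : ℕ) (F : ℕ → ℝ) : ℝ :=
  l1Norm fun x : Fin n → Fin 2 => F (weight x)

/-- Fixing the last bit to 0 preserves weights and sends each character to its restriction; pairs of
characters merge. -/
theorem levelNorm_le_succ (n : ℕ) (F : ℕ → ℝ) : levelNorm n F ≤ levelNorm (n + 1) F := by
  refine l1Norm_le_of_eq_sum (J := univ)
    (c := fourierCoeff fun x : Fin (n + 1) → Fin 2 => F (weight x))
    (T := fun S => univ.filter fun i : Fin n => i.castSucc ∈ S) fun x => ?_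
  have hw : weight x = weight (Fin.snoc x 0 : Fin (n + 1) → Fin 2) := by
    simp [weight, Fin.sum_univ_castSucc]
  simp only [hw]
  rw [fourier_inversion (fun x : Fin (n + 1) → Fin 2 => F (weight x)) (Fin.snoc x 0)]
  refine sum_congr rfl fun S _ => ?_
  congr 1
  simp only [chi]
  congr 1
  rw [← univ_inter S, ← sum_ite_mem, sum_filter, Fin.sum_univ_castSucc]
  simp

theorem levelNorm_mono {m n : ℕ} (h : m ≤ n) (F : ℕ → ℝ) : levelNorm m F ≤ levelNorm n F :=
  monotone_nat_of_le_succ (f := fun n => levelNorm n F) (fun n => levelNorm_le_succ n F) h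

theorem levelNorm_flip_le (n : ℕ) (F : ℕ → ℝ) :
    levelNorm n (fun k => F (n - k)) ≤ levelNorm n F := by
  let f : (Fin n → Fin 2) → ℝ := fun x => F (weight x)
  have h := l1Norm_le_of_eq_sum (h := fun x : Fin n → Fin 2 => F (n - weight x)) (J := univ)
    (c := fun S => fourierCoeff f S * (-1) ^ #S) (T := id) fun x => ?_
  · simp only [abs_mul, abs_pow, abs_neg, abs_one, one_pow, mul_one] at h
    exact h
  obtain ⟨U, rfl⟩ := (indicator_bijective n).2 x
  have hw : n - weight (indicator U) = weight (indicator Uᶜ) := by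
    simp [weight_indicator, card_compl]
  rw [hw]
  change f _ = _
  rw [fourier_inversion f]
  refine sum_congr rfl fun S _ => ?_
  rw [mul_assoc]
  congr 1
  simp only [chi_indicator, id]
  have h1 : #(S ∩ U) + #(S ∩ Uᶜ) = #S := by
    rw [← card_union_of_disjoint, ← inter_union_distrib_left, union_compl, inter_univ]
    exact disjoint_left.mpr fun i hi hj => by simp_all
  rw [← h1, pow_add, mul_comm ((-1 : ℝ) ^ #(S ∩ U)), mul_assoc, ← pow_add, ← two_mul, pow_mul]
  simp

theorem levelNorm_neg_one_pow_mul_le (n : ℕ) (F : ℕ → ℝ) :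
    levelNorm n (fun k => F k * (-1) ^ k) ≤ levelNorm n F :=
  l1Norm_mul_parity_le fun x => F (weight x)

/-- The sum factors over coordinates: each one in `S` contributes `1 - z`, each other one `1 + z`.
It is used with `z = X` and with `z` imaginary. -/
theorem sum_pow_card_mul_neg_one_pow {R : Type*} [CommRing R] {n : ℕ} (S : Finset (Fin n)) (z : R) :
    ∑ U : Finset (Fin n), z ^ #U * (-1) ^ #(S ∩ U) = (1 - z) ^ #S * (1 + z) ^ (n - #S) := by
  have h : ∏ i : Fin n, (1 + (if i ∈ S then -z else z)) =
      (1 - z) ^ #S * (1 + z) ^ (n - #S) := by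
    have : ∀ i : Fin n, (1 + (if i ∈ S then -z else z)) = if i ∈ S then 1 - z else 1 + z := by
      intro i; split_ifs <;> ring
    simp only [this]
    rw [prod_ite]
    simp [filter_not, card_sdiff, prod_const]
  rw [← h, prod_one_add, powerset_univ]
  refine sum_congr rfl fun U _ => ?_
  have : ∀ i : Fin n, (if i ∈ S then -z else z) = z * if i ∈ S then -1 else 1 := by
    intro i; split_ifs <;> ring
  simp only [this, prod_mul_distrib, prod_const]
  congr 1
  rw [prod_ite]
  simp [filter_mem_eq_inter, inter_comm]

/-- The generating polynomial of the Krawtchouk numbers. -/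
noncomputable def krawtchouk (n s : ℕ) : ℝ[X] := (1 - X) ^ s * (1 + X) ^ (n - s)

theorem sum_card_mul_neg_one_pow {n : ℕ} (G : ℕ → ℝ) (S : Finset (Fin n)) :
    ∑ U : Finset (Fin n), G #U * (-1) ^ #(S ∩ U) =
      ∑ k ∈ range (n + 1), G k * (krawtchouk n #S).coeff k := by
  have h : ∀ k, (krawtchouk n #S).coeff k =
      ∑ U : Finset (Fin n), if #U = k then (-1) ^ #(S ∩ U) else 0 := by
    intro k
    rw [krawtchouk, ← sum_pow_card_mul_neg_one_pow S (X : ℝ[X]), finsetSum_coeff]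
    refine sum_congr rfl fun U _ => ?_
    have : ((-1 : ℝ[X]) ^ #(S ∩ U)) = C ((-1 : ℝ) ^ #(S ∩ U)) := by simp
    rw [this, coeff_mul_C, coeff_X_pow]
    simp [eq_comm]
  simp only [h, mul_sum]
  rw [sum_comm]
  refine sum_congr rfl fun U _ => ?_
  have hU : #U ∈ range (n + 1) := by
    rw [mem_range, Nat.lt_succ_iff]
    simpa using card_le_univ U
  simp only [mul_ite, mul_zero]
  rw [sum_ite_eq, if_pos hU]

/-- The Fourier coefficient at every set of size `s` of the symmetric function with level
values `F`. -/
noncomputable def levelCoeff (n : ℕ) (F : ℕ → ℝ) (s : ℕ) : ℝ :=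
  (∑ k ∈ range (n + 1), F k * (krawtchouk n s).coeff k) / 2 ^ n

theorem fourierCoeff_eq_levelCoeff {n : ℕ} (F : ℕ → ℝ) (S : Finset (Fin n)) :
    fourierCoeff (fun x => F (weight x)) S = levelCoeff n F #S := by
  rw [fourierCoeff, levelCoeff, sum_cube, ← sum_card_mul_neg_one_pow]
  simp only [weight_indicator, chi_indicator]

/-- As `#(S ∩ U)` is symmetric in `S` and `U`, the same Krawtchouk numbers serve for the transform
and its inverse. -/
theorem level_inversion {n k : ℕ} (hk : k ≤ n) (F : ℕ → ℝ) :
    F k = ∑ s ∈ range (n + 1), levelCoeff n F s * (krawtchouk n k).coeff s := by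
  obtain ⟨U, -, rfl⟩ := exists_subset_card_eq (s := (univ : Finset (Fin n))) (n := k)
    (by simpa using hk)
  rw [← sum_card_mul_neg_one_pow]
  have := fourier_inversion (fun x : Fin n → Fin 2 => F (weight x)) (indicator U)
  simp only [weight_indicator, fourierCoeff_eq_levelCoeff, chi_indicator] at this
  simpa only [inter_comm] using this

theorem levelNorm_eq_sum (n : ℕ) (F : ℕ → ℝ) :
    levelNorm n F = ∑ s ∈ range (n + 1), (n.choose s : ℝ) * |levelCoeff n F s| := by
  have := sum_powerset_apply_card (fun s => |levelCoeff n F s|) (x := (univ : Finset (Fin n)))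
  simp only [powerset_univ, card_univ, Fintype.card_fin, nsmul_eq_mul] at this
  rw [← this]
  simp only [levelNorm, l1Norm, fourierCoeff_eq_levelCoeff]

end SymmetricSpectral

/-! ### Lower bound by finite differences around the middle level -/

namespace SymmetricSpectral

open Finset Polynomial

/-- One term of Vandermonde's identity for `2(a + t) = a + (a + 2t)`, combined with unimodality: `u
+ t` lies between `t` and `(a + 2t) - t`. -/
theorem choose_mul_choose_le (a t u : ℕ) (hu : u ≤ a) :
    a.choose u * (a + 2 * t).choose t ≤ (2 * (a + t)).choose (2 * u + t) := by
  have h1 : (a + 2 * t).choose t ≤ (a + 2 * t).choose (u + t) := by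
    have h := Nat.choose_mul (n := a + 2 * t) (k := u + t) (s := t) (by omega)
    have h2 : (u + t).choose t ≤ (a + 2 * t - t).choose (u + t - t) := by
      rw [show u + t - t = u by omega, ← Nat.choose_symm_add]
      exact Nat.choose_le_choose _ (by omega)
    have h3 : 0 < (u + t).choose t := Nat.choose_pos (by omega)
    refine Nat.le_of_mul_le_mul_right ?_ h3
    rw [h]
    exact Nat.mul_le_mul_left _ h2
  have h2 : 2 * (a + t) = a + (a + 2 * t) := by ring
  rw [h2, Nat.add_choose_eq a (a + 2 * t)]
  refine (Nat.mul_le_mul_left _ h1).trans ?_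
  exact single_le_sum (f := fun ij : ℕ × ℕ => a.choose ij.1 * (a + 2 * t).choose ij.2)
    (fun _ _ => Nat.zero_le _)
    (show (u, u + t) ∈ antidiagonal (2 * u + t) by rw [HasAntidiagonal.mem_antidiagonal]; ring)

/-- All terms share the factor `(1 - X²)^a`; the binomial theorem turns the rest into `((1 - X)² -
(1 + X)²)^t = (-4X)^t`. This cancellation makes the window cheap. -/
theorem sum_krawtchouk_window (a t : ℕ) :
    ∑ j ∈ range (t + 1), C ((-1 : ℝ) ^ (t - j) * t.choose j) *
      krawtchouk (2 * (a + t)) (a + 2 * j) =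
    ∑ u ∈ range (a + 1), monomial (2 * u + t) ((-1 : ℝ) ^ u * a.choose u * (-4) ^ t) := by
  have h1 : ∑ j ∈ range (t + 1), C ((-1 : ℝ) ^ (t - j) * t.choose j) *
      krawtchouk (2 * (a + t)) (a + 2 * j) =
      (1 - X ^ 2) ^ a * ((1 - X) ^ 2 + -(1 + X) ^ 2) ^ t := by
    rw [add_pow, mul_sum]
    refine sum_congr rfl fun j hj => ?_
    have hj : j ≤ t := by rw [mem_range] at hj; omega
    rw [krawtchouk, show 2 * (a + t) - (a + 2 * j) = a + 2 * (t - j) by omega, pow_add, pow_add,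
      pow_mul, pow_mul, neg_pow ((1 + X : ℝ[X]) ^ 2),
      show (1 - X ^ 2 : ℝ[X]) = (1 - X) * (1 + X) by ring, mul_pow]
    simp only [C_mul, C_pow, C_neg, C_1, map_natCast]
    ring
  have h2 : ((1 - X) ^ 2 + -(1 + X) ^ 2 : ℝ[X]) = C (-4) * X := by
    have : (C (-4) : ℝ[X]) = -4 := by rw [map_neg, map_ofNat]
    rw [this]; ring
  rw [h1, h2, show (1 - X ^ 2 : ℝ[X]) = -X ^ 2 + 1 by ring, add_pow, sum_mul]
  refine sum_congr rfl fun u _ => ?_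
  rw [← C_mul_X_pow_eq_monomial]
  simp only [C_mul, C_pow, map_natCast, one_pow, mul_one, C_neg, C_1, mul_pow]
  rw [neg_pow, ← pow_mul, pow_add]
  ring

theorem abs_coeff_window_le (a t s : ℕ) :
    |(∑ u ∈ range (a + 1), monomial (2 * u + t)
      ((-1 : ℝ) ^ u * a.choose u * (-4) ^ t)).coeff s| * (a + 2 * t).choose t ≤
      4 ^ t * (2 * (a + t)).choose s := by
  simp only [finsetSum_coeff, coeff_monomial]
  by_cases h : ∃ u ∈ range (a + 1), 2 * u + t = s
  · obtain ⟨u, hu, rfl⟩ := h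
    rw [sum_eq_single u (fun v _ hv => if_neg (by omega)) (fun h => absurd hu h), if_pos rfl]
    have := choose_mul_choose_le a t u (by rw [mem_range] at hu; omega)
    have h2 : (a.choose u : ℝ) * (a + 2 * t).choose t ≤ (2 * (a + t)).choose (2 * u + t) := by
      exact_mod_cast this
    simp only [abs_mul, abs_pow, abs_neg, abs_one, one_pow, one_mul, Nat.abs_cast, Nat.abs_ofNat]
    calc (a.choose u : ℝ) * 4 ^ t * (a + 2 * t).choose t
        = 4 ^ t * ((a.choose u : ℝ) * (a + 2 * t).choose t) := by ring
      _ ≤ _ := by gcongr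
  · rw [sum_eq_zero fun u hu => if_neg fun hs => h ⟨u, hu, hs⟩]
    simp only [abs_zero, zero_mul]
    positivity

/-- The spectral norm controls the finite differences with step two of the level values, taken
symmetrically around the middle level. -/
theorem abs_window_mul_choose_le (a t : ℕ) (F : ℕ → ℝ) :
    |∑ j ∈ range (t + 1), (-1 : ℝ) ^ (t - j) * t.choose j * F (a + 2 * j)| *
      (a + 2 * t).choose t ≤ 4 ^ t * levelNorm (2 * (a + t)) F := by
  set n := 2 * (a + t) with hn
  have h : ∑ j ∈ range (t + 1), (-1 : ℝ) ^ (t - j) * t.choose j * F (a + 2 * j) =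
      ∑ s ∈ range (n + 1), levelCoeff n F s * (∑ u ∈ range (a + 1), monomial (2 * u + t)
        ((-1 : ℝ) ^ u * a.choose u * (-4) ^ t)).coeff s := by
    simp only [← sum_krawtchouk_window, finsetSum_coeff, coeff_C_mul, mul_sum]
    rw [sum_comm]
    refine sum_congr rfl fun j hj => ?_
    rw [level_inversion (n := n) (k := a + 2 * j) (by rw [mem_range] at hj; omega) F, mul_sum]
    exact sum_congr rfl fun s _ => by ring
  rw [h, levelNorm_eq_sum, mul_sum]
  refine (mul_le_mul_of_nonneg_right (abs_sum_le_sum_abs _ _) (Nat.cast_nonneg _)).trans ?_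
  rw [sum_mul]
  refine sum_le_sum fun s _ => ?_
  rw [abs_mul, mul_assoc, ← mul_assoc (4 ^ t), mul_comm (4 ^ t * _)]
  exact mul_le_mul_of_nonneg_left (abs_coeff_window_le a t s) (abs_nonneg _)

/-- If all these differences vanished, `G` would agree on `2t` points with a polynomial of degree
below `t`. One of the two values is taken at least `t` times, so the polynomial would be constant.
-/
theorem exists_finite_difference_ne_zero {t : ℕ} (ht : 1 ≤ t) {G : ℕ → ℝ}
    (hG : ∀ j < 2 * t, G j = -1 ∨ G j = 1)
    {i₁ i₂ : ℕ} (h₁ : i₁ < 2 * t) (h₂ : i₂ < 2 * t) (hne : G i₁ ≠ G i₂) :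
    ∃ b, b < t ∧ ∑ j ∈ range (t + 1), (-1 : ℝ) ^ (t - j) * t.choose j * G (b + j) ≠ 0 := by
  by_contra! hcon
  let P : ℝ[X] := Lagrange.interpolate (range t) (fun i : ℕ => (i : ℝ)) G
  have hinj : Set.InjOn (fun i : ℕ => (i : ℝ)) (range t : Set ℕ) := Nat.cast_injective.injOn
  have hdeg : P.degree < t := by
    have h := Lagrange.degree_interpolate_lt G hinj
    rwa [card_range] at h
  have hPdiff : ∀ b : ℕ, ∑ j ∈ range (t + 1), (-1 : ℝ) ^ (t - j) * t.choose j *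
      P.eval ((b + j : ℕ) : ℝ) = 0 := by
    intro b
    have hnat : P.natDegree < t := by
      by_cases hP : P = 0
      · rw [hP, natDegree_zero]; omega
      · exact (natDegree_lt_iff_degree_lt hP).2 hdeg
    have := congrFun (fwdDiff_iter_eq_zero_of_degree_lt hnat) (b : ℝ)
    rw [fwdDiff_iter_eq_sum_shift] at this
    simpa [mul_assoc] using this
  have hPG : ∀ j < 2 * t, P.eval (j : ℝ) = G j := by
    intro j
    induction j using Nat.strong_induction_on with
    | _ j ih =>
      intro hj
      by_cases hjt : j < t
      · exact Lagrange.eval_interpolate_at_node G hinj (by simpa using hjt)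
      · obtain ⟨b, rfl⟩ : ∃ b, j = b + t := ⟨j - t, by omega⟩
        have e1 := hcon b (by omega)
        have e2 := hPdiff b
        rw [sum_range_succ] at e1 e2
        have e3 : ∑ j ∈ range t, (-1 : ℝ) ^ (t - j) * t.choose j * P.eval ((b + j : ℕ) : ℝ) =
            ∑ j ∈ range t, (-1 : ℝ) ^ (t - j) * t.choose j * G (b + j) := by
          refine sum_congr rfl fun i hi => ?_
          rw [mem_range] at hi
          rw [ih (b + i) (by omega) (by omega)]
        simp only [Nat.sub_self, pow_zero, Nat.choose_self, Nat.cast_one, one_mul] at e1 e2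
        linarith
  have hconst : ∀ v : ℝ, t ≤ #{j ∈ range (2 * t) | G j = v} → False := by
    intro v hv
    have hcard := card_image_of_injective ({j ∈ range (2 * t) | G j = v})
      (Nat.cast_injective (R := ℝ))
    have hP : P = C v := by
      refine eq_of_degrees_lt_of_eval_finset_eq
        (({j ∈ range (2 * t) | G j = v}).image ((↑) : ℕ → ℝ)) ?_ ?_ ?_
      · rw [hcard]
        exact hdeg.trans_le (by exact_mod_cast hv)
      · rw [hcard]
        refine degree_C_le.trans_lt ?_
        have : 0 < #{j ∈ range (2 * t) | G j = v} := by omega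
        exact_mod_cast this
      · intro x hx
        obtain ⟨j, hj, rfl⟩ := mem_image.mp hx
        rw [mem_filter, mem_range] at hj
        rw [hPG j hj.1, hj.2, eval_C]
    apply hne
    rw [← hPG i₁ h₁, ← hPG i₂ h₂, hP, eval_C, eval_C]
  have hsum : #{j ∈ range (2 * t) | G j = -1} + #{j ∈ range (2 * t) | ¬ G j = -1} = 2 * t := by
    rw [card_filter_add_card_filter_not, card_range]
  have heq : ({j ∈ range (2 * t) | ¬ G j = -1}) = {j ∈ range (2 * t) | G j = 1} := by
    refine filter_congr fun j hj => ?_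
    rcases hG j (mem_range.mp hj) with h | h <;> rw [h] <;> norm_num
  rw [heq] at hsum
  rcases le_or_gt t #{j ∈ range (2 * t) | G j = -1} with h | h
  · exact hconst _ h
  · exact hconst 1 (by omega)

theorem pow_le_choose_cast {N t : ℕ} (h : 9 * t ≤ N + 1) : (8 : ℝ) ^ t ≤ N.choose t := by
  refine le_trans ?_ (Nat.pow_le_choose t N)
  rw [le_div_iff₀ (by positivity)]
  have h1 : (t.factorial : ℝ) ≤ (t : ℝ) ^ t := by exact_mod_cast Nat.factorial_le_pow t
  have h2 : (8 * t : ℝ) ≤ ((N + 1 - t : ℕ) : ℝ) := by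
    exact_mod_cast (by omega : 8 * t ≤ N + 1 - t)
  calc (8 : ℝ) ^ t * t.factorial ≤ 8 ^ t * t ^ t := by gcongr
    _ = (8 * t : ℝ) ^ t := by rw [mul_pow]
    _ ≤ _ := by gcongr

theorem two_pow_le_levelNorm {n R t : ℕ} {F : ℕ → ℝ} (hF : ∀ k ≤ n, F k = -1 ∨ F k = 1)
    (hR : 1 ≤ R) (hn : 2 * R ≤ n) (hne : F (R - 1) ≠ F (R + 1)) (ht : 1 ≤ t)
    (htR : 11 * t ≤ R + 3) : (2 : ℝ) ^ t ≤ levelNorm n F := by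
  -- The `2t` levels, two apart, end at `R - 1` and `R + 1`, so the sequence is nonconstant. Every
  -- window in it has its centre `a + t` at most `R`, hence at most `n/2`.
  obtain ⟨b, hb, hb0⟩ := exists_finite_difference_ne_zero ht
    (G := fun j => F (R + 3 - 4 * t + 2 * j)) (fun j hj => hF _ (by omega))
    (i₁ := 2 * t - 2) (i₂ := 2 * t - 1) (by omega) (by omega) (by
      rwa [show R + 3 - 4 * t + 2 * (2 * t - 2) = R - 1 by omega,
        show R + 3 - 4 * t + 2 * (2 * t - 1) = R + 1 by omega])
  set a := R + 3 - 4 * t + 2 * b with ha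
  simp only [show ∀ j, R + 3 - 4 * t + 2 * (b + j) = a + 2 * j from fun j => by omega] at hb0
  have hint : ∃ z : ℤ, ∑ j ∈ range (t + 1), (-1 : ℝ) ^ (t - j) * t.choose j * F (a + 2 * j) = z := by
    have : ∀ k, ∃ z : ℤ, k ≤ n → F k = z := by
      intro k
      by_cases hk : k ≤ n
      · rcases hF k hk with h | h
        · exact ⟨-1, fun _ => by simpa using h⟩
        · exact ⟨1, fun _ => by simpa using h⟩
      · exact ⟨0, fun h => absurd h hk⟩
    choose z hz using this
    refine ⟨∑ j ∈ range (t + 1), (-1) ^ (t - j) * t.choose j * z (a + 2 * j), ?_⟩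
    push_cast
    refine sum_congr rfl fun j hj => ?_
    rw [mem_range] at hj
    rw [hz _ (by omega)]
  obtain ⟨z, hz⟩ := hint
  -- A nonzero integer has absolute value at least 1.
  have h1 : (1 : ℝ) ≤ |∑ j ∈ range (t + 1), (-1 : ℝ) ^ (t - j) * t.choose j * F (a + 2 * j)| := by
    rw [hz] at hb0 ⊢
    exact_mod_cast Int.one_le_abs (by exact_mod_cast hb0)
  have h2 := abs_window_mul_choose_le a t F
  have h3 : (8 : ℝ) ^ t ≤ (a + 2 * t).choose t := pow_le_choose_cast (by omega)
  have h4 := levelNorm_mono (m := 2 * (a + t)) (n := n) (by omega) F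
  have h5 : (8 : ℝ) ^ t = 4 ^ t * 2 ^ t := by rw [← mul_pow]; norm_num
  have h6 : (0 : ℝ) < 4 ^ t := by positivity
  refine le_of_mul_le_mul_left ?_ h6
  calc (4 : ℝ) ^ t * 2 ^ t = 1 * 8 ^ t := by rw [h5, one_mul]
    _ ≤ _ := mul_le_mul h1 h3 (by positivity) (abs_nonneg _)
    _ ≤ _ := h2
    _ ≤ _ := by gcongr

theorem three_halves_le_levelNorm {n R : ℕ} {F : ℕ → ℝ} (hF : ∀ k ≤ n, F k = -1 ∨ F k = 1)
    (hR : 2 ≤ R) (hn : 2 * R ≤ n) (hne : F (R - 1) ≠ F (R + 1)) :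
    3 / 2 ≤ levelNorm n F := by
  have h1 := abs_window_mul_choose_le (R - 1) 1 F
  have h2 := levelNorm_mono (m := 2 * (R - 1 + 1)) (n := n) (by omega) F
  rw [show R - 1 + 2 * 1 = R + 1 by omega] at h1
  simp only [sum_range_succ, range_zero, sum_empty, Nat.choose_one_right] at h1
  simp only [show R - 1 + 2 * 1 = R + 1 by omega] at h1
  have h3 : (2 : ℝ) ≤ R := by exact_mod_cast hR
  norm_num at h1
  rcases hF (R - 1) (by omega) with e | e <;> rcases hF (R + 1) (by omega) with e' | e' <;>
    rw [e, e'] at hne h1 <;>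
    first | exact absurd rfl hne | (norm_num at h1; linarith)

end SymmetricSpectral

/-! ### Lower bound by generating functions on the imaginary axis -/

namespace SymmetricSpectral

open Finset

/-- By Fourier expansion the sum becomes a combination of `(1 - z)^s (1 + z)^(n - s)`. For imaginary
`z` both factors have modulus `√(1 + θ²)`, so every character has the same small cost. -/
theorem norm_sum_level_mul_pow_le (n : ℕ) (G : ℕ → ℝ) (θ : ℝ) :
    ‖∑ k ∈ range (n + 1), (n.choose k : ℂ) * (G k * (Complex.I * θ) ^ k)‖ ≤
      levelNorm n G * Real.exp (n * (θ ^ 2 / 2)) := by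
  set z : ℂ := Complex.I * θ with hz
  have hnorm : ∀ ε : ℝ, ε ^ 2 = 1 → ‖1 + ε * z‖ ≤ Real.exp (θ ^ 2 / 2) := by
    intro ε hε
    have h1 : ‖1 + ε * z‖ ^ 2 = 1 + θ ^ 2 := by
      rw [← Complex.normSq_eq_norm_sq, hz,
        show (1 : ℂ) + ε * (Complex.I * θ) = (1 : ℝ) + (ε * θ : ℝ) * Complex.I by push_cast; ring,
        Complex.normSq_add_mul_I, mul_pow, hε]
      ring
    refine le_of_sq_le_sq ?_ (Real.exp_pos _).le
    rw [h1, ← Real.exp_nat_mul, add_comm]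
    refine (Real.add_one_le_exp _).trans (le_of_eq ?_)
    congr 1
    push_cast; ring
  have hplus : ‖1 + z‖ ≤ Real.exp (θ ^ 2 / 2) := by simpa using hnorm 1 (by norm_num)
  have hminus : ‖1 - z‖ ≤ Real.exp (θ ^ 2 / 2) := by
    simpa [← sub_eq_add_neg] using hnorm (-1) (by norm_num)
  have h1 := sum_powerset_apply_card (fun k => (G k : ℂ) * z ^ k) (x := (univ : Finset (Fin n)))
  simp only [powerset_univ, card_univ, Fintype.card_fin, nsmul_eq_mul] at h1
  have h2 : ∀ U : Finset (Fin n), (G #U : ℂ) =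
      ∑ S : Finset (Fin n), (levelCoeff n G #S : ℂ) * (-1) ^ #(S ∩ U) := by
    intro U
    have := fourier_inversion (fun x : Fin n → Fin 2 => G (weight x)) (indicator U)
    simp only [weight_indicator, fourierCoeff_eq_levelCoeff, chi_indicator] at this
    exact_mod_cast congrArg ((↑) : ℝ → ℂ) this
  have h3 : ∑ U : Finset (Fin n), (G #U : ℂ) * z ^ #U =
      ∑ S : Finset (Fin n), (levelCoeff n G #S : ℂ) * ((1 - z) ^ #S * (1 + z) ^ (n - #S)) := by
    simp only [h2, ← sum_pow_card_mul_neg_one_pow, sum_mul, mul_sum]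
    rw [sum_comm]
    exact sum_congr rfl fun _ _ => sum_congr rfl fun _ _ => by ring
  rw [← h1, h3]
  have h4 : levelNorm n G = ∑ S : Finset (Fin n), |levelCoeff n G #S| := by
    simp only [levelNorm, l1Norm, fourierCoeff_eq_levelCoeff]
  rw [h4, sum_mul]
  refine (norm_sum_le _ _).trans (sum_le_sum fun S _ => ?_)
  rw [norm_mul, Complex.norm_real, Real.norm_eq_abs]
  refine mul_le_mul_of_nonneg_left ?_ (abs_nonneg _)
  rw [norm_mul, norm_pow, norm_pow, Real.exp_nat_mul]
  have hS : #S ≤ n := by simpa using card_le_univ S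
  calc ‖1 - z‖ ^ #S * ‖1 + z‖ ^ (n - #S)
      ≤ Real.exp (θ ^ 2 / 2) ^ #S * Real.exp (θ ^ 2 / 2) ^ (n - #S) := by gcongr
    _ = _ := by rw [← pow_add, Nat.add_sub_cancel' hS]

/-- The `d`-th difference annihilates powers below `d` and sends the `d`-th power to `d!`; it
extracts the leading coefficient. -/
theorem sum_neg_one_pow_mul_choose_mul_sum_pow (d : ℕ) (p : ℕ → ℂ) :
    ∑ j ∈ range (d + 1), (-1 : ℂ) ^ (d - j) * d.choose j *
      ∑ k ∈ range (d + 1), p k * (j : ℂ) ^ k = p d * d.factorial := by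
  have h : ∀ k ≤ d, ∑ j ∈ range (d + 1), (-1 : ℂ) ^ (d - j) * d.choose j * (j : ℂ) ^ k =
      if k = d then (d.factorial : ℂ) else 0 := by
    intro k hk
    have h1 := fwdDiff_iter_eq_sum_shift (1 : ℂ) (fun r => r ^ k) d 0
    simp only [zero_add, nsmul_eq_mul, mul_one, zsmul_eq_mul] at h1
    push_cast at h1
    rw [← h1]
    split_ifs with hkd
    · subst hkd
      rw [fwdDiff_iter_eq_factorial]
      rfl
    · rw [fwdDiff_iter_pow_eq_zero_of_lt (lt_of_le_of_ne hk hkd)]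
      rfl
  simp only [mul_sum]
  rw [sum_comm]
  calc _ = ∑ k ∈ range (d + 1), p k * if k = d then (d.factorial : ℂ) else 0 := by
        refine sum_congr rfl fun k hk => ?_
        rw [← h k (by rw [mem_range] at hk; omega), mul_sum]
        exact sum_congr rfl fun _ _ => by ring
    _ = _ := by simp

/-- A symmetric function supported on the levels `0, …, d` and large on level `d` has large
spectral norm. -/
theorem pow_le_levelNorm_of_support {n d : ℕ} (hd : 1 ≤ d) (hdn : 2 * d ≤ n) {G : ℕ → ℝ}
    (hG : ∀ k ≤ n, d < k → G k = 0) :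
    |G d| * (Real.sqrt (n / d) / 8) ^ d ≤ levelNorm n G := by
  have hd0 : (0 : ℝ) < d := by exact_mod_cast hd
  have hn0 : (0 : ℝ) < n := by exact_mod_cast (by omega : 0 < n)
  -- With this step the sample points satisfy `n (h j)² / 2 ≤ d / 2` for `j ≤ d`, so the exponential
  -- loss is at most `e^(d/2) ≤ 2^d`.
  set h : ℝ := 1 / Real.sqrt (n * d) with hh
  have hh0 : 0 < h := by positivity
  have hsq : h ^ 2 = 1 / (n * d) := by
    rw [hh, div_pow, Real.sq_sqrt (by positivity), one_pow]
  have hbound : ∀ j ∈ range (d + 1),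
      ‖∑ k ∈ range (d + 1), ((n.choose k : ℂ) * (G k * (Complex.I * h) ^ k)) * (j : ℂ) ^ k‖ ≤
        levelNorm n G * 2 ^ d := by
    intro j hj
    have hjd : (j : ℝ) ≤ d := by
      rw [mem_range] at hj
      exact_mod_cast (by omega : j ≤ d)
    have e : ∑ k ∈ range (d + 1), ((n.choose k : ℂ) * (G k * (Complex.I * h) ^ k)) * (j : ℂ) ^ k =
        ∑ k ∈ range (n + 1), (n.choose k : ℂ) * (G k * (Complex.I * (h * j : ℝ)) ^ k) := by
      rw [← sum_subset (range_subset_range.2 (by omega : d + 1 ≤ n + 1))]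
      · refine sum_congr rfl fun k _ => ?_
        push_cast
        ring
      · intro k hk hk'
        rw [mem_range] at hk hk'
        rw [hG k (by omega) (by omega)]
        simp
    rw [e]
    refine (norm_sum_level_mul_pow_le n G (h * j)).trans ?_
    refine mul_le_mul_of_nonneg_left ?_ (l1Norm_nonneg _)
    have e2 : (n : ℝ) * ((h * j) ^ 2 / 2) ≤ d * (1 / 2) := by
      rw [mul_pow, hsq]
      calc (n : ℝ) * (1 / (n * d) * (j : ℝ) ^ 2 / 2) ≤ n * (1 / (n * d) * (d : ℝ) ^ 2 / 2) := by gcongr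
        _ = (d : ℝ) * (1 / 2) := by field_simp
    refine (Real.exp_le_exp.2 e2).trans ?_
    rw [Real.exp_nat_mul]
    refine pow_le_pow_left₀ (Real.exp_pos _).le ?_ d
    refine le_of_sq_le_sq ?_ (by norm_num)
    rw [← Real.exp_nat_mul]
    have := Real.exp_one_lt_d9
    norm_num
    linarith
  have hlead := sum_neg_one_pow_mul_choose_mul_sum_pow d
    fun k => (n.choose k : ℂ) * (G k * (Complex.I * h) ^ k)
  have hle : (n.choose d : ℝ) * (|G d| * h ^ d) * d.factorial ≤ 2 ^ d * (levelNorm n G * 2 ^ d) := by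
    have e := congrArg norm hlead
    simp only [norm_mul, norm_pow, Complex.norm_I, Complex.norm_natCast, Complex.norm_real,
      Real.norm_eq_abs, one_mul, abs_of_pos hh0] at e
    rw [← e]
    refine (norm_sum_le _ _).trans ?_
    have e2 : (2 : ℝ) ^ d = ∑ j ∈ range (d + 1), (d.choose j : ℝ) := by
      exact_mod_cast (Nat.sum_range_choose d).symm
    conv_rhs => rw [e2, sum_mul]
    rw [← e2]
    refine sum_le_sum fun j hj => ?_
    rw [norm_mul]
    simp only [norm_mul, norm_pow, norm_neg, norm_one, one_pow, one_mul, Complex.norm_natCast]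
    exact mul_le_mul_of_nonneg_left (hbound j hj) (Nat.cast_nonneg _)
  have hchoose : ((n : ℝ) / 2) ^ d ≤ (n.choose d : ℝ) * d.factorial := by
    have e1 : ((n + 1 - d) ^ d : ℕ) ≤ d.factorial * n.choose d := by
      rw [← Nat.descFactorial_eq_factorial_mul_choose]
      exact Nat.pow_sub_le_descFactorial n d
    have e2 : (n : ℝ) / 2 ≤ ((n + 1 - d : ℕ) : ℝ) := by
      have : (n : ℝ) ≤ ((2 * (n + 1 - d) : ℕ) : ℝ) := by exact_mod_cast (by omega)
      push_cast at this
      linarith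
    calc ((n : ℝ) / 2) ^ d ≤ ((n + 1 - d : ℕ) : ℝ) ^ d := by gcongr
      _ ≤ (n.choose d : ℝ) * d.factorial := by
        rw [mul_comm]; exact_mod_cast e1
  have hsqrt : Real.sqrt (n / d) = n * h := by
    rw [Real.sqrt_eq_iff_mul_self_eq_of_pos (by positivity)]
    calc (n : ℝ) * h * (n * h) = n ^ 2 * h ^ 2 := by ring
      _ = n / d := by rw [hsq]; field_simp
  rw [hsqrt]
  have h4 : (0 : ℝ) < 2 ^ d * 2 ^ d := by positivity
  refine le_of_mul_le_mul_left ?_ h4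
  calc (2 : ℝ) ^ d * 2 ^ d * (|G d| * (n * h / 8) ^ d)
      = |G d| * h ^ d * (n / 2) ^ d := by
        have : (8 : ℝ) = 2 * 2 * 2 := by norm_num
        rw [this]
        simp only [div_pow, mul_pow]
        field_simp
    _ ≤ |G d| * h ^ d * ((n.choose d : ℝ) * d.factorial) := by gcongr
    _ = (n.choose d : ℝ) * (|G d| * h ^ d) * d.factorial := by ring
    _ ≤ _ := hle
    _ = _ := by ring

theorem one_le_levelNorm {n : ℕ} {F : ℕ → ℝ} (hF : ∀ k ≤ n, F k = -1 ∨ F k = 1) :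
    1 ≤ levelNorm n F := by
  refine le_trans (le_of_eq ?_) (abs_le_l1Norm _ (fun _ => 0))
  rcases hF (weight (n := n) fun _ => 0) (weight_le _) with h | h <;> rw [h] <;> norm_num

/-- Lower bound for a symmetric function that is constant on the levels `R, …, n - R`. -/
theorem pow_le_levelNorm {n R : ℕ} {F : ℕ → ℝ} (hF : ∀ k ≤ n, F k = -1 ∨ F k = 1)
    (hR : 2 ≤ R) (hn : 4 * R ≤ n) (hconst : ∀ k, R ≤ k → k + R ≤ n → F k = F R)
    (hne : F (R - 1) ≠ F R) :
    (Real.sqrt (n / (2 * R)) / 8) ^ (R - 1) ≤ levelNorm n F := by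
  -- Keeping only `n - R` coordinates removes the upper levels, where `F` may again vary.
  have h1 := pow_le_levelNorm_of_support (n := n - R) (d := R - 1) (by omega) (by omega)
    (G := fun k => F k - F R)
    (fun k hk hk' => by rw [hconst k (by omega) (by omega), sub_self])
  have hG : |F (R - 1) - F R| = 2 := by
    rcases hF (R - 1) (by omega) with h | h <;> rcases hF R (by omega) with h' | h' <;>
      rw [h, h'] at hne ⊢ <;> first | exact absurd rfl hne | norm_num
  have h2 : levelNorm (n - R) (fun k => F k - F R) ≤ 2 * levelNorm n F := by
    have e1 : levelNorm (n - R) (fun k => F k - F R) ≤ levelNorm (n - R) F + |F R| :=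
      l1Norm_sub_const_le (fun x : Fin (n - R) → Fin 2 => F (weight x)) (F R)
    have e2 := levelNorm_mono (Nat.sub_le n R) F
    have e3 := one_le_levelNorm hF
    have e4 : |F R| = 1 := by
      rcases hF R (by omega) with h | h <;> rw [h] <;> norm_num
    linarith
  have h3 : (n : ℝ) / (2 * R) ≤ ((n - R : ℕ) : ℝ) / ((R - 1 : ℕ) : ℝ) := by
    have e1 : (0 : ℝ) < ((R - 1 : ℕ) : ℝ) := by exact_mod_cast (by omega : 0 < R - 1)
    have e2 : (n : ℝ) ≤ 2 * ((n - R : ℕ) : ℝ) := by exact_mod_cast (by omega)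
    have e3 : ((R - 1 : ℕ) : ℝ) ≤ R := by exact_mod_cast (by omega)
    calc (n : ℝ) / (2 * R) ≤ 2 * ((n - R : ℕ) : ℝ) / (2 * ((R - 1 : ℕ) : ℝ)) := by gcongr
      _ = _ := by field_simp
  have h4 : (Real.sqrt (n / (2 * R)) / 8) ^ (R - 1) ≤
      (Real.sqrt (((n - R : ℕ) : ℝ) / ((R - 1 : ℕ) : ℝ)) / 8) ^ (R - 1) := by
    gcongr
  rw [hG] at h1
  linarith

end SymmetricSpectral

/-! ### Level form of the cutoff and reduction to a normal form -/

namespace SymmetricSpectral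

open Finset

theorem exists_levels {n : ℕ} {f : (Fin n → Fin 2) → ℝ} (hs : IsSymmetric f) :
    ∃ F : ℕ → ℝ, f = fun x => F (weight x) := by
  classical
  refine ⟨fun k => if h : k ≤ n then f (exists_weight_eq h).choose else 0, funext fun x => ?_⟩
  simp only [dif_pos (weight_le x)]
  exact eq_of_weight_eq hs (exists_weight_eq (weight_le x)).choose_spec.symm

theorem constOn_level_iff {n : ℕ} {F : ℕ → ℝ} {a b : ℕ} :
    ConstOn (fun x : Fin n → Fin 2 => F (weight x)) a b ↔
      ∃ c, ∀ k, a ≤ k → k + b ≤ n → F k = c := by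
  refine exists_congr fun c => ⟨fun h k h1 h2 => ?_, fun h x h1 h2 => h _ h1 h2⟩
  obtain ⟨x, rfl⟩ := exists_weight_eq (n := n) (k := k) (by omega)
  exact h x h1 h2

/-- The cutoff condition in terms of level values. -/
def LevelCutoff (n : ℕ) (F : ℕ → ℝ) (a b : ℕ) : Prop :=
  2 * a ≤ n ∧ 2 * b ≤ n ∧ ((∃ c, ∀ k, a ≤ k → k + b ≤ n → F k = c) ∨
    ∃ c, ∀ k, a ≤ k → k + b ≤ n → F k * (-1) ^ k = c)

theorem isCutoff_level_iff {n : ℕ} {F : ℕ → ℝ} {p : ℕ × ℕ} :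
    IsCutoff (fun x : Fin n → Fin 2 => F (weight x)) p ↔ LevelCutoff n F p.1 p.2 := by
  unfold IsCutoff LevelCutoff
  rw [constOn_level_iff]
  simp only [parity]
  rw [constOn_level_iff (F := fun k => F k * (-1) ^ k)]

theorem neg_one_pow_eq_sub_mul {n k : ℕ} (h : k ≤ n) :
    (-1 : ℝ) ^ k = (-1) ^ (n - k) * (-1) ^ n := by
  obtain ⟨m, rfl⟩ := Nat.exists_eq_add_of_le h
  rw [Nat.add_sub_cancel_left, ← pow_add, show m + (k + m) = k + 2 * m by ring, pow_add, pow_mul]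
  simp

theorem LevelCutoff.flip {n : ℕ} {F : ℕ → ℝ} {a b : ℕ} (h : LevelCutoff n F a b) :
    LevelCutoff n (fun k => F (n - k)) b a := by
  obtain ⟨ha, hb, ⟨c, hc⟩ | ⟨c, hc⟩⟩ := h
  · exact ⟨hb, ha, Or.inl ⟨c, fun k h1 h2 => hc _ (by omega) (by omega)⟩⟩
  · refine ⟨hb, ha, Or.inr ⟨c * (-1) ^ n, fun k h1 h2 => ?_⟩⟩
    rw [neg_one_pow_eq_sub_mul (by omega : k ≤ n), ← mul_assoc, hc _ (by omega) (by omega)]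

theorem LevelCutoff.of_flip {n : ℕ} {F : ℕ → ℝ} {a b : ℕ}
    (h : LevelCutoff n (fun k => F (n - k)) b a) : LevelCutoff n F a b := by
  have e : ∀ k ≤ n, F (n - (n - k)) = F k := fun k hk => by rw [Nat.sub_sub_self hk]
  obtain ⟨hb, ha, hc⟩ := h.flip
  refine ⟨hb, ha, hc.imp ?_ ?_⟩ <;>
  · rintro ⟨c, hc⟩
    refine ⟨c, fun k h1 h2 => ?_⟩
    rw [← hc k h1 h2]
    simp only [e k (by omega)]

theorem exists_normal_form_left {n : ℕ} {F : ℕ → ℝ} (hF : ∀ k ≤ n, F k = -1 ∨ F k = 1)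
    {a b : ℕ} (ha : 1 ≤ a) (h : LevelCutoff n F a b) (hmin : ¬ LevelCutoff n F (a - 1) b) :
    ∃ F' : ℕ → ℝ, (∀ k ≤ n, F' k = -1 ∨ F' k = 1) ∧ levelNorm n F' ≤ levelNorm n F ∧
      (∀ k, a ≤ k → k + b ≤ n → F' k = F' a) ∧ F' (a - 1) ≠ F' a ∧ F' (a + 1) = F' a := by
  obtain ⟨h1, h2, hc⟩ := h
  -- Otherwise `[a - 1, n - b]` holds only two adjacent levels, and a sign function on those is
  -- constant or alternating, against minimality.
  have hlt : a + 1 + b ≤ n := by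
    by_contra hlt
    apply hmin
    have hk : ∀ k, a - 1 ≤ k → k + b ≤ n → k = a - 1 ∨ k = a := fun k _ _ => by omega
    have hs : (-1 : ℝ) ^ a = (-1) ^ (a - 1) * -1 := by
      rw [← pow_succ, Nat.sub_add_cancel ha]
    refine ⟨by omega, h2, ?_⟩
    by_cases e : F (a - 1) = F a
    · refine Or.inl ⟨F a, fun k h3 h4 => ?_⟩
      rcases hk k h3 h4 with rfl | rfl
      · exact e
      · rfl
    · have e' : F (a - 1) = -F a := by
        rcases hF (a - 1) (by omega) with h3 | h3 <;> rcases hF a (by omega) with h4 | h4 <;>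
          rw [h3, h4] at e ⊢ <;> first | exact absurd rfl e | norm_num
      refine Or.inr ⟨F a * (-1) ^ a, fun k h3 h4 => ?_⟩
      rcases hk k h3 h4 with rfl | rfl
      · rw [e', hs]; ring
      · rfl
  have key : ∀ F' : ℕ → ℝ, (∃ c, ∀ k, a ≤ k → k + b ≤ n → F' k = c) →
      (¬ ∃ c, ∀ k, a - 1 ≤ k → k + b ≤ n → F' k = c) →
      (∀ k, a ≤ k → k + b ≤ n → F' k = F' a) ∧ F' (a - 1) ≠ F' a ∧ F' (a + 1) = F' a := by
    rintro F' ⟨c, hc⟩ hn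
    have hall : ∀ k, a ≤ k → k + b ≤ n → F' k = F' a := fun k h3 h4 => by
      rw [hc k h3 h4, hc a le_rfl (by omega)]
    refine ⟨hall, fun e => hn ⟨F' a, fun k h3 h4 => ?_⟩, hall _ (by omega) hlt⟩
    rcases Nat.lt_or_ge k a with h5 | h5
    · rw [show k = a - 1 by omega, e]
    · exact hall k h5 h4
  rcases hc with hc | hc
  · exact ⟨F, hF, le_rfl, key F hc fun h => hmin ⟨by omega, h2, Or.inl h⟩⟩
  · refine ⟨fun k => F k * (-1) ^ k, fun k hk => ?_, levelNorm_neg_one_pow_mul_le n F,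
      key _ hc fun h => hmin ⟨by omega, h2, Or.inr h⟩⟩
    rcases hF k hk with h | h <;> rcases neg_one_pow_eq_or ℝ k with h' | h' <;>
      simp [h, h']

theorem exists_normal_form {n : ℕ} {F : ℕ → ℝ} (hF : ∀ k ≤ n, F k = -1 ∨ F k = 1)
    {p : ℕ × ℕ} (hp : Minimal (IsCutoff fun x : Fin n → Fin 2 => F (weight x)) p)
    {R : ℕ} (hR : max p.1 p.2 = R) (hR1 : 1 ≤ R) :
    ∃ F' : ℕ → ℝ, (∀ k ≤ n, F' k = -1 ∨ F' k = 1) ∧ levelNorm n F' ≤ levelNorm n F ∧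
      (∀ k, R ≤ k → k + R ≤ n → F' k = F' R) ∧ F' (R - 1) ≠ F' R ∧ F' (R + 1) = F' R := by
  obtain ⟨a, b⟩ := p
  have hc := isCutoff_level_iff.1 hp.1
  have hmin : ∀ a' b', LevelCutoff n F a' b' → a' ≤ a → b' ≤ b → a ≤ a' ∧ b ≤ b' :=
    fun a' b' h h1 h2 => hp.2 (y := (a', b')) (isCutoff_level_iff.2 h) ⟨h1, h2⟩
  dsimp only at hc hR
  rcases le_total b a with hab | hab
  · obtain rfl : a = R := by omega
    obtain ⟨F', h1, h2, h3, h4⟩ := exists_normal_form_left hF hR1 hc fun h => by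
      have := hmin _ _ h (by omega) le_rfl
      omega
    exact ⟨F', h1, h2, fun k hk hk' => h3 k hk (by omega), h4⟩
  · obtain rfl : b = R := by omega
    obtain ⟨F', h1, h2, h3, h4⟩ := exists_normal_form_left (F := fun k => F (n - k))
      (fun k _ => hF _ (Nat.sub_le n k)) hR1 hc.flip fun h => by
        have := hmin _ _ h.of_flip le_rfl (by omega)
        omega
    exact ⟨F', h1, h2.trans (levelNorm_flip_le n F), fun k hk hk' => h3 k hk (by omega), h4⟩

/-! ### Upper bound by binomial tails -/

theorem levelNorm_le_of_const {n : ℕ} {F : ℕ → ℝ} (hF : ∀ k ≤ n, |F k| ≤ 1) {a b R : ℕ}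
    (haR : a ≤ R) (hbR : b ≤ R) (hR : 2 * R ≤ n) {c : ℝ}
    (hc : ∀ k, a ≤ k → k + b ≤ n → F k = c) :
    levelNorm n F ≤ 1 + 4 * ∑ k ∈ range R, (n.choose k : ℝ) := by
  have hc1 : |c| ≤ 1 := by
    rw [← hc a le_rfl (by omega)]
    exact hF a (by omega)
  have h1 : levelNorm n F ≤ l1Norm (fun x : Fin n → Fin 2 => F (weight x) - c) + |c| :=
    l1Norm_add_const_le (fun x : Fin n → Fin 2 => F (weight x)) c
  have h2 := l1Norm_le_sum_abs (fun x : Fin n → Fin 2 => F (weight x) - c)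
  have h3 := sum_powerset_apply_card (fun k => |F k - c|) (x := (univ : Finset (Fin n)))
  simp only [powerset_univ, card_univ, Fintype.card_fin, nsmul_eq_mul] at h3
  rw [sum_cube] at h2
  simp only [weight_indicator] at h2
  rw [h3] at h2
  have h4 : ∑ k ∈ range (n + 1), (n.choose k : ℝ) * (if k < R then 2 else 0) =
      2 * ∑ k ∈ range R, (n.choose k : ℝ) := by
    simp only [mul_ite, mul_zero]
    rw [← sum_filter, mul_sum]
    refine sum_congr ?_ fun _ _ => mul_comm _ _
    ext k
    simp only [mem_filter, mem_range]
    omega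
  have h5 : ∑ k ∈ range (n + 1), (n.choose k : ℝ) * (if n - k < R then 2 else 0) =
      2 * ∑ k ∈ range R, (n.choose k : ℝ) := by
    rw [← h4, ← sum_flip]
    refine sum_congr rfl fun k hk => ?_
    have hk : k ≤ n := by rw [mem_range] at hk; omega
    rw [Nat.choose_symm hk, Nat.sub_sub_self hk]
  have h6 : ∑ k ∈ range (n + 1), (n.choose k : ℝ) * |F k - c| ≤
      ∑ k ∈ range (n + 1), (n.choose k : ℝ) * (if k < R then 2 else 0) +
      ∑ k ∈ range (n + 1), (n.choose k : ℝ) * (if n - k < R then 2 else 0) := by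
    rw [← sum_add_distrib]
    refine sum_le_sum fun k hk => ?_
    rw [← mul_add]
    refine mul_le_mul_of_nonneg_left ?_ (Nat.cast_nonneg _)
    have hk : k ≤ n := by rw [mem_range] at hk; omega
    have h7 : |F k - c| ≤ 2 := by
      have := abs_sub (F k) c
      have := hF k hk
      linarith
    by_cases hin : a ≤ k ∧ k + b ≤ n
    · rw [hc k hin.1 hin.2, sub_self, abs_zero]
      positivity
    · split_ifs <;> first | linarith | omega
  linarith

theorem levelNorm_le_of_cutoff {n : ℕ} {F : ℕ → ℝ} (hF : ∀ k ≤ n, |F k| ≤ 1) {a b R : ℕ}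
    (haR : a ≤ R) (hbR : b ≤ R) (hR : 2 * R ≤ n) (h : LevelCutoff n F a b) :
    levelNorm n F ≤ 1 + 4 * ∑ k ∈ range R, (n.choose k : ℝ) := by
  obtain ⟨-, -, ⟨c, hc⟩ | ⟨c, hc⟩⟩ := h
  · exact levelNorm_le_of_const hF haR hbR hR hc
  · refine le_trans ?_ (levelNorm_le_of_const (F := fun k => F k * (-1) ^ k)
      (fun k hk => by simpa [abs_mul, abs_pow] using hF k hk) haR hbR hR hc)
    have := levelNorm_neg_one_pow_mul_le n fun k => F k * (-1) ^ k
    simpa only [mul_assoc, ← mul_pow, neg_mul_neg, one_mul, one_pow, mul_one] using this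

/-- In the binomial expansion of `(p + q)^n = 1` with `p = R/n`, each term with `k < R` has weight
at least `p^(2R)`. -/
theorem sum_choose_le {n R : ℕ} (hR : 2 * R ≤ n) :
    ∑ k ∈ range R, (n.choose k : ℝ) ≤ ((n : ℝ) / R) ^ (2 * R) := by
  rcases Nat.eq_zero_or_pos R with rfl | hR0
  · simp
  have hRr : (0 : ℝ) < R := by exact_mod_cast hR0
  have hnr : (2 : ℝ) * R ≤ n := by exact_mod_cast hR
  have hn0 : (0 : ℝ) < n := by linarith
  set p : ℝ := R / n with hp
  set q : ℝ := 1 - p with hq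
  have hp0 : 0 < p := by positivity
  have hpq : p ≤ q := by
    rw [hq, le_sub_iff_add_le, hp, ← add_div, div_le_one hn0]
    linarith
  have hpow : p ^ R ≤ q ^ (n - R) := by
    have hnR : (0 : ℝ) < n - R := by linarith
    -- The weight `R/(n - R)` on `p` makes the arithmetic mean of `p` and `1` exactly `q`.
    have h1 := Real.geom_mean_le_arith_mean2_weighted (w₁ := R / (n - R)) (w₂ := 1 - R / (n - R))
      (p₁ := p) (p₂ := 1) (by positivity)
      (by rw [sub_nonneg, div_le_one hnR]; linarith) hp0.le zero_le_one (by ring)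
    rw [Real.one_rpow, mul_one, mul_one] at h1
    have h2 : (R : ℝ) / (n - R) * p + (1 - R / (n - R)) = q := by
      rw [hq, hp]
      field_simp
      ring
    rw [h2] at h1
    have h3 := pow_le_pow_left₀ (Real.rpow_nonneg hp0.le _) h1 (n - R)
    rw [← Real.rpow_mul_natCast hp0.le, Nat.cast_sub (by omega), div_mul_cancel₀ _ hnR.ne',
      Real.rpow_natCast] at h3
    exact h3
  have hsum : (∑ k ∈ range R, (n.choose k : ℝ)) * p ^ (2 * R) ≤ 1 := by
    have h1 : (1 : ℝ) = ∑ k ∈ range (n + 1), p ^ k * q ^ (n - k) * n.choose k := by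
      rw [← add_pow, hq, add_sub_cancel, one_pow]
    rw [h1, sum_mul]
    refine le_trans (sum_le_sum fun k hk => ?_)
      (sum_le_sum_of_subset_of_nonneg (range_subset_range.2 (by omega : R ≤ n + 1))
        fun k _ _ => by have := hp0.trans_le hpq; positivity)
    rw [mem_range] at hk
    rw [mul_comm]
    refine mul_le_mul_of_nonneg_right ?_ (Nat.cast_nonneg _)
    calc p ^ (2 * R) = p ^ k * (p ^ (R - k) * p ^ R) := by
          rw [← pow_add, ← pow_add]; congr 1; omega
      _ ≤ p ^ k * (q ^ (R - k) * q ^ (n - R)) := by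
          have := hp0.trans_le hpq
          gcongr
      _ = p ^ k * q ^ (n - k) := by
          rw [← pow_add]; congr 2; omega
  have hinv : (n : ℝ) / R = p⁻¹ := by rw [hp, inv_div]
  rw [hinv, inv_pow, ← one_div, le_div_iff₀ (by positivity)]
  exact hsum

/-! ### Logarithmic bounds and the theorem -/

theorem logb_le {n R : ℕ} {A : ℝ} (hR : 2 * R ≤ n) (hA : 1 ≤ A)
    (h : A ≤ 1 + 4 * ∑ k ∈ range R, (n.choose k : ℝ)) :
    Real.logb 2 A ≤ 2 * (R : ℝ) * Real.logb 2 ((n : ℝ) / R) + 3 := by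
  rcases Nat.eq_zero_or_pos R with rfl | hR0
  · simp only [range_zero, sum_empty, mul_zero, add_zero] at h
    obtain rfl : A = 1 := le_antisymm h hA
    simp
  have hRr : (0 : ℝ) < R := by exact_mod_cast hR0
  have hnr : (2 : ℝ) * R ≤ n := by exact_mod_cast hR
  have h1 : (1 : ℝ) ≤ (n : ℝ) / R := by rw [le_div_iff₀ hRr]; linarith
  have h2 : (1 : ℝ) ≤ ((n : ℝ) / R) ^ (2 * R) := one_le_pow₀ h1
  have h3 := sum_choose_le hR
  have h4 : A ≤ ((n : ℝ) / R) ^ (2 * R) * 2 ^ 3 := by linarith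
  have h5 := Real.logb_le_logb_of_le (b := 2) (by norm_num) (by linarith) h4
  rw [Real.logb_mul (by positivity) (by positivity), Real.logb_pow, Real.logb_pow,
    Real.logb_self_eq_one (by norm_num)] at h5
  push_cast at h5
  linarith

theorem le_logb {n R : ℕ} {F : ℕ → ℝ} (hF : ∀ k ≤ n, F k = -1 ∨ F k = 1) (hR : 2 ≤ R)
    (hn : 2 * R ≤ n) (hconst : ∀ k, R ≤ k → k + R ≤ n → F k = F R) (hne : F (R - 1) ≠ F R)
    (heq : F (R + 1) = F R) :
    1 / 400 * ((R : ℝ) * Real.logb 2 ((n : ℝ) / R)) ≤ Real.logb 2 (levelNorm n F) := by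
  have hRr : (2 : ℝ) ≤ R := by exact_mod_cast hR
  have hnr : (2 : ℝ) * R ≤ n := by exact_mod_cast hn
  have hx2 : (2 : ℝ) ≤ (n : ℝ) / R := by rw [le_div_iff₀ (by linarith)]; linarith
  set x : ℝ := (n : ℝ) / R with hx
  have hlog0 : 0 ≤ Real.logb 2 x := Real.logb_nonneg (by norm_num) (by linarith)
  have hA := one_le_levelNorm hF
  -- As `y² = x/128`, the threshold `2^14 = 128²` is where `x ≤ y^4` begins to hold; then `log y` is
  -- at least a quarter of `log x`.
  rcases le_or_gt (2 ^ 14) x with hbig | hsmall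
  · have h4 : 4 * R ≤ n := by
      have : (4 : ℝ) * R ≤ n := by
        rw [hx, le_div_iff₀ (by linarith)] at hbig
        linarith
      exact_mod_cast this
    have h1 := pow_le_levelNorm hF hR h4 hconst hne
    set y : ℝ := Real.sqrt (n / (2 * R)) / 8 with hy
    have hy2 : y ^ 2 = x / 128 := by
      rw [hy, div_pow, Real.sq_sqrt (by positivity), hx]
      field_simp
      ring
    have hyx : x ≤ y ^ 4 := by
      have : y ^ 4 = (y ^ 2) ^ 2 := by ring
      rw [this, hy2]
      nlinarith
    have h2 : 0 ≤ y := by positivity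
    have hy0 : 0 < y := lt_of_le_of_ne h2 fun h => by rw [← h] at hyx; norm_num at hyx; linarith
    have h3 := Real.logb_le_logb_of_le (b := 2) (by norm_num) (by positivity) h1
    have h5 := Real.logb_le_logb_of_le (b := 2) (by norm_num) (by linarith) hyx
    rw [Real.logb_pow] at h3 h5
    rw [Nat.cast_sub (by omega)] at h3
    push_cast at h3 h5
    nlinarith
  · have h14 : Real.logb 2 x ≤ 14 := by
      have := Real.logb_le_logb_of_le (b := 2) (by norm_num) (by linarith) hsmall.le
      rw [Real.logb_pow, Real.logb_self_eq_one (by norm_num)] at this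
      push_cast at this
      linarith
    have hne' : F (R - 1) ≠ F (R + 1) := by rwa [heq]
    -- Here `log x ≤ 14`, so a bound linear in `R` suffices: `28 · 14 = 392 ≤ 400`. Below `R = 14`
    -- the constant bound `log (3/2) ≥ 1/2` covers `R/28`.
    have hlin : (R : ℝ) / 28 ≤ Real.logb 2 (levelNorm n F) := by
      rcases Nat.lt_or_ge R 14 with h | h
      · have h1 := three_halves_le_levelNorm hF hR hn hne'
        have h2 : (2 : ℝ) ≤ levelNorm n F ^ 2 := by nlinarith
        have h3 := Real.logb_le_logb_of_le (b := 2) (by norm_num) (by norm_num) h2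
        rw [Real.logb_pow, Real.logb_self_eq_one (by norm_num)] at h3
        push_cast at h3
        have h4 : (R : ℝ) ≤ 14 := by exact_mod_cast h.le
        linarith
      · have h1 := two_pow_le_levelNorm (t := (R + 3) / 11) hF (by omega) hn hne' (by omega)
          (by omega)
        have h3 := Real.logb_le_logb_of_le (b := 2) (by norm_num) (by positivity) h1
        rw [Real.logb_pow, Real.logb_self_eq_one (by norm_num), mul_one] at h3
        have h4 : (R : ℝ) ≤ 28 * (((R + 3) / 11 : ℕ) : ℝ) := by
          exact_mod_cast (by omega : R ≤ 28 * ((R + 3) / 11))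
        linarith
    nlinarith

end SymmetricSpectral

theorem theorem1 :
    -- the two-sided bound for `r(f) > 1`, with universal constants
    (∃ c C : ℝ, 0 < c ∧ 0 < C ∧
      ∀ (n : ℕ) (f : (Fin n → Fin 2) → ℝ),
        SymmetricSpectral.IsBoolean f → SymmetricSpectral.IsSymmetric f →
        1 < SymmetricSpectral.r f →
          c * ((SymmetricSpectral.r f : ℝ) *
              Real.logb 2 ((n : ℝ) / (SymmetricSpectral.r f : ℝ))) ≤
            Real.logb 2 (SymmetricSpectral.l1Norm f) ∧
          Real.logb 2 (SymmetricSpectral.l1Norm f) ≤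
            C * ((SymmetricSpectral.r f : ℝ) *
              Real.logb 2 ((n : ℝ) / (SymmetricSpectral.r f : ℝ)))) ∧
    -- the two-sided bound for `r(f) ≤ 1`, with universal constants
    (∃ c C : ℝ, 0 < c ∧ 0 < C ∧
      ∀ (n : ℕ) (f : (Fin n → Fin 2) → ℝ),
        SymmetricSpectral.IsBoolean f → SymmetricSpectral.IsSymmetric f →
        SymmetricSpectral.r f ≤ 1 →
          c ≤ SymmetricSpectral.l1Norm f ∧ SymmetricSpectral.l1Norm f ≤ C) ∧
    -- the explicit upper bound
    (∀ (n : ℕ) (f : (Fin n → Fin 2) → ℝ), 1 ≤ n →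
        SymmetricSpectral.IsBoolean f → SymmetricSpectral.IsSymmetric f →
          Real.logb 2 (SymmetricSpectral.l1Norm f) ≤
            2 * (SymmetricSpectral.r f : ℝ) *
              Real.logb 2 ((n : ℝ) / (SymmetricSpectral.r f : ℝ)) + 3) := by
  open SymmetricSpectral Finset in
  have main : ∀ (n : ℕ) (f : (Fin n → Fin 2) → ℝ), IsBoolean f → IsSymmetric f →
      2 * r f ≤ n ∧ 1 ≤ l1Norm f ∧
      l1Norm f ≤ 1 + 4 * ∑ k ∈ range (r f), (n.choose k : ℝ) ∧
      (1 < r f → 1 / 400 * ((r f : ℝ) * Real.logb 2 ((n : ℝ) / r f)) ≤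
        Real.logb 2 (l1Norm f)) := by
    intro n f hb hs
    obtain ⟨p, hp⟩ := exists_minimal_isCutoff hb hs
    have hpr := max_eq_r hb hp
    obtain ⟨F, rfl⟩ := exists_levels hs
    have hF : ∀ k ≤ n, F k = -1 ∨ F k = 1 := by
      intro k hk
      obtain ⟨x, rfl⟩ := exists_weight_eq hk
      exact hb x
    have hF1 : ∀ k ≤ n, |F k| ≤ 1 := by
      intro k hk
      rcases hF k hk with h | h <;> rw [h] <;> norm_num
    generalize r (fun x : Fin n → Fin 2 => F (weight x)) = R at hpr ⊢
    have hc := isCutoff_level_iff.1 hp.1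
    have hn : 2 * R ≤ n := by
      have := hc.1
      have := hc.2.1
      omega
    refine ⟨hn, one_le_levelNorm hF,
      levelNorm_le_of_cutoff hF1 (by omega) (by omega) hn hc, fun hR => ?_⟩
    obtain ⟨F', h1, h2, h3, h4, h5⟩ := exists_normal_form hF hp hpr (by omega)
    have h6 : 0 < levelNorm n F' := zero_lt_one.trans_le (one_le_levelNorm h1)
    exact (le_logb h1 hR hn h3 h4 h5).trans
      (Real.logb_le_logb_of_le (by norm_num) h6 h2)
  -- For `r ≥ 2` one has `r log (n/r) ≥ 2`, so `4` absorbs the additive `3`; for `r ≤ 1` the tail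
  -- sum is at most 1, giving `1 + 4 = 5`.
  refine ⟨⟨1 / 400, 4, by norm_num, by norm_num, fun n f hb hs hr => ?_⟩,
    ⟨1, 5, by norm_num, by norm_num, fun n f hb hs hr => ?_⟩, fun n f _ hb hs => ?_⟩
  · obtain ⟨hn, h1, h2, h3⟩ := main n f hb hs
    refine ⟨h3 hr, (SymmetricSpectral.logb_le hn h1 h2).trans ?_⟩
    have hRr : (2 : ℝ) ≤ SymmetricSpectral.r f := by exact_mod_cast hr
    have hnr : (2 : ℝ) * SymmetricSpectral.r f ≤ n := by exact_mod_cast hn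
    have hL : 1 ≤ Real.logb 2 ((n : ℝ) / SymmetricSpectral.r f) := by
      rw [Real.le_logb_iff_rpow_le (by norm_num) (div_pos (by linarith) (by linarith)),
        Real.rpow_one, le_div_iff₀ (by linarith)]
      exact hnr
    nlinarith
  · obtain ⟨-, h1, h2, -⟩ := main n f hb hs
    refine ⟨h1, h2.trans ?_⟩
    have : ∑ k ∈ Finset.range (SymmetricSpectral.r f), (n.choose k : ℝ) ≤
        ∑ k ∈ Finset.range 1, (n.choose k : ℝ) :=
      Finset.sum_le_sum_of_subset_of_nonneg (Finset.range_subset_range.2 hr)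
        fun _ _ _ => Nat.cast_nonneg _
    simp only [Finset.range_one, Finset.sum_singleton, Nat.choose_zero_right, Nat.cast_one] at this
    linarith
  · obtain ⟨hn, h1, h2, -⟩ := main n f hb hs
    exact SymmetricSpectral.logb_le hn h1 h2
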